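/- Let $n\ge 1$ and let $O_n$ be the linear crossed octagonal graph: the simple graph with the $6n+2$ vertices $1,2,\ldots,3n+1$ and $1',2',\ldots,(3n+1)'$, whose $13n+1$ edges are $\{i,i+1\}$, $\{i',(i+1)'\}$, $\{i,(i+1)'\}$, $\{i',i+1\}$ for $1\le i\le 3n$, together with $\{3k+1,(3k+1)'\}$ for $0\le k\le n$. (That is, $O_n$ is a linear chain of $n$ octagons, consecutive ones sharing an edge, in which three pairs of crossed edges are added to each octagon.) Then the number $\tau(O_n)$ of spanning trees of $O_n$, i.e. of subgraphs of $O_n$ that contain all vertices of $O_n$ and are trees, is $$\tau(O_n)=2^{8n+2}\cdot 3^{\,n-1}.$$ -/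

import Mathlib

/-- The linear crossed octagonal graph `O_n` on `6 * n + 2` vertices. The vertex `(i, false)` stands
for the vertex `i + 1` of the first boundary path `1, 2, …, 3n+1`, and `(i, true)` for the vertex
`(i + 1)'` of the second one `1', 2', …, (3n+1)'`.
If two positions are consecutive, all four edges between them are present: two edges of the
boundary paths (equal second coordinate) and a pair of crossed edges (distinct second coordinate).
The rungs `{i, i'}` are present for `i = 1, 4, 7, …, 3n+1`, i.e. at the positions divisible by `3`
when positions are counted from `0`; two consecutive rungs bound an octagon. -/
def linearCrossedOctagonalGraph (n : ℕ) : SimpleGraph (Fin (3 * n + 1) × Bool) where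
  Adj u v :=
    ((u.1 : ℕ) + 1 = v.1 ∨ (v.1 : ℕ) + 1 = u.1) ∨
      (u.1 = v.1 ∧ u.2 ≠ v.2 ∧ 3 ∣ (u.1 : ℕ))
  symm := ⟨by
    rintro u v (h | ⟨h1, h2, h3⟩)
    · exact Or.inl h.symm
    · exact Or.inr ⟨h1.symm, h2.symm, h1 ▸ h3⟩⟩
  loopless := ⟨by
    rintro u (h | ⟨_, h, _⟩)
    · omega
    · exact h rfl⟩

/-- The number of spanning trees of a (finite) graph `G`: the number of subgraphs of `G` which
contain every vertex of `G` and are trees. -/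
noncomputable def numSpanningTrees {V : Type*} (G : SimpleGraph V) : ℕ :=
  {T : G.Subgraph | T.IsSpanning ∧ T.coe.IsTree}.ncard

/-! Let `L` be the Laplacian and `u` the indicator of the two vertices at position `0`. Rows and
columns of `L` sum to zero, so `det (L + u uᵀ) = (∑ u)² τ = 4 τ` by the matrix-tree theorem and
`det_add_vecMulVec_of_sum_eq_zero`. Exchanging `i` and `i'` is a symmetry, so this determinant is
`det (A + B) * det (A - B)` for blocks `A`, `B`. In `A + B` the rungs cancel, leaving `2 DᵀD` with
`D` unitriangular: determinant `2 ^ (3n+1)`. In `A - B` the path and crossed edges cancel, leaving a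
diagonal with `n - 1` entries `6` and `2n + 2` entries `4`. The product is `4 * 2 ^ (8n+2) * 3 ^
(n-1)`. The matrix-tree theorem itself comes from orienting spanning trees towards a root and
expanding the determinant by rows. -/

/-! ### Spanning trees as parent maps -/

section ParentMaps

variable {V : Type*}

/-- Every vertex is eventually sent to `r` under iteration of `f`. -/
def ReachesRoot (f : V → V) (r : V) : Prop := ∀ v, ∃ k : ℕ, f^[k] v = r

/-- A parent map of `G` with root `r` sends every vertex other than `r` to a neighbour, and
every vertex eventually to `r`. -/
structure IsParentMap (G : SimpleGraph V) (r : V) (f : V → V) : Prop where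
  root : f r = r
  adj : ∀ v, v ≠ r → G.Adj v (f v)
  reaches : ReachesRoot f r

/-- The graph joining each vertex to its image under `f`. -/
def functionalGraph (f : V → V) : SimpleGraph V := SimpleGraph.fromRel fun u v => f u = v

theorem ReachesRoot.apply_ne {f : V → V} {r v : V} (h : ReachesRoot f r) (hv : v ≠ r) :
    f v ≠ v := by
  intro hf
  obtain ⟨k, hk⟩ := h v
  rw [Function.iterate_fixed hf] at hk
  exact hv hk

theorem ReachesRoot.apply_apply_ne {f : V → V} {r v : V} (h : ReachesRoot f r) (hr : f r = r)
    (hv : v ≠ r) : f (f v) ≠ v := by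
  intro hf
  have key : ∀ k : ℕ, f^[k] v ≠ r ∧ f (f^[k] v) ≠ r := by
    intro k
    induction k with
    | zero =>
      refine ⟨hv, fun h' => hv ?_⟩
      rw [← hf]
      rw [show f v = r from h', hr]
    | succ k ih =>
      rw [Function.iterate_succ_apply']
      refine ⟨ih.2, ?_⟩
      rw [← Function.iterate_succ_apply' f, ← Function.iterate_succ_apply' f,
        Function.iterate_succ_apply, Function.iterate_succ_apply, hf]
      exact ih.1
  obtain ⟨k, hk⟩ := h v
  exact (key k).1 hk

theorem functionalGraph_connected {f : V → V} {r : V} (h : ReachesRoot f r) :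
    (functionalGraph f).Connected := by
  have hstep : ∀ v, (functionalGraph f).Reachable v (f v) := by
    intro v
    by_cases hv : v = f v
    · rw [← hv]
    · exact SimpleGraph.Adj.reachable ((SimpleGraph.fromRel_adj _ _ _).2 ⟨hv, Or.inl rfl⟩)
  have hiter : ∀ (k : ℕ) v, (functionalGraph f).Reachable v (f^[k] v) := by
    intro k
    induction k with
    | zero => exact fun v => SimpleGraph.Reachable.refl v
    | succ k ih => exact fun v => (hstep v).trans (ih (f v))
  have hr : ∀ v, (functionalGraph f).Reachable v r := by
    intro v
    obtain ⟨k, hk⟩ := h v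
    exact hk ▸ hiter k v
  have : Nonempty V := ⟨r⟩
  exact ⟨fun u v => (hr u).trans (hr v).symm⟩

/-- Every edge is `{v, f v}` with `v ≠ r`, so there are at most `|V| - 1` edges; connectedness then
forces a tree. -/
theorem functionalGraph_isTree [Finite V] {f : V → V} {r : V} (h : ReachesRoot f r)
    (hr : f r = r) : (functionalGraph f).IsTree := by
  have hconn := functionalGraph_connected h
  refine SimpleGraph.isTree_iff_connected_and_card.2
    ⟨hconn, le_antisymm ?_ hconn.card_vert_le_card_edgeSet_add_one⟩
  have hsub : (functionalGraph f).edgeSet ⊆ (fun v => s(v, f v)) '' {v | v ≠ r} := by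
    intro e
    induction e with
    | _ u v =>
      rw [SimpleGraph.mem_edgeSet, functionalGraph, SimpleGraph.fromRel_adj]
      rintro ⟨hne, rfl | rfl⟩
      · exact ⟨u, fun h' => hne (by rw [h', hr]), rfl⟩
      · exact ⟨v, fun h' => hne (by rw [h', hr]), Sym2.eq_swap⟩
  have hcard : (functionalGraph f).edgeSet.ncard ≤ ({v | v ≠ r} : Set V).ncard :=
    (Set.ncard_le_ncard hsub (Set.toFinite _)).trans (Set.ncard_image_le (Set.toFinite _))
  have hcompl : ({v | v ≠ r} : Set V).ncard + 1 = Nat.card V := by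
    have := Set.ncard_add_ncard_compl ({r} : Set V)
    rw [Set.ncard_singleton] at this
    rw [← this, add_comm]
    rfl
  rw [← hcompl]
  exact Nat.add_le_add_right hcard 1

/-- Induction on the steps from `v` to `r`: if the edge `{v, f v}` came from `g (f v) = v`, then `f
(f v) = v` by induction, a 2-cycle that never reaches `r`. -/
theorem functionalGraph_injOn {f g : V → V} {r : V} (hf : ReachesRoot f r) (hfr : f r = r)
    (hgr : g r = r) (hfg : functionalGraph f = functionalGraph g) : f = g := by
  have key : ∀ (k : ℕ) v, f^[k] v = r → f v = g v := by
    intro k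
    induction k with
    | zero =>
      rintro v rfl
      exact hfr.trans hgr.symm
    | succ k ih =>
      intro v hv
      by_cases hvr : v = r
      · rw [hvr, hfr, hgr]
      have hadj : (functionalGraph f).Adj v (f v) :=
        (SimpleGraph.fromRel_adj _ _ _).2 ⟨(hf.apply_ne hvr).symm, Or.inl rfl⟩
      rw [hfg, functionalGraph, SimpleGraph.fromRel_adj] at hadj
      rcases hadj.2 with h | h
      · exact h.symm
      · exact absurd ((ih (f v) hv).trans h) (hf.apply_apply_ne hfr hvr)
  funext v
  obtain ⟨k, hk⟩ := hf v
  exact key k v hk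

/-- The parent is the next vertex on a shortest path to `r`. The resulting connected subgraph of `H`
is all of `H`, since trees are minimal connected graphs. -/
theorem SimpleGraph.IsTree.exists_isParentMap {G H : SimpleGraph V} (hH : H.IsTree) (hle : H ≤ G)
    (r : V) : ∃ f, IsParentMap G r f ∧ functionalGraph f = H := by
  classical
  have hstep : ∀ v, v ≠ r → ∃ w, H.Adj v w ∧ H.dist w r + 1 = H.dist v r := by
    intro v hv
    obtain ⟨p, hp⟩ := hH.connected.exists_walk_length_eq_dist v r
    cases p with
    | nil => exact absurd rfl hv
    | @cons _ w _ hadj q =>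
      refine ⟨w, hadj, le_antisymm ?_ ?_⟩
      · rw [← hp, SimpleGraph.Walk.length_cons]
        exact Nat.add_le_add_right (SimpleGraph.dist_le q) 1
      · have h1 := hH.connected.dist_triangle (u := v) (v := w) (w := r)
        rw [SimpleGraph.dist_eq_one_iff_adj.2 hadj] at h1
        omega
  choose! p hadj hdist using hstep
  have hne : ∀ v, v ≠ r → (if v = r then r else p v) = p v := fun v hv => if_neg hv
  have hreach : ReachesRoot (fun v => if v = r then r else p v) r := by
    suffices ∀ (k : ℕ) v, H.dist v r = k → (fun v => if v = r then r else p v)^[k] v = r from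
      fun v => ⟨_, this _ v rfl⟩
    intro k
    induction k with
    | zero => exact fun v hv => hH.connected.dist_eq_zero_iff.1 hv
    | succ k ih =>
      intro v hv
      have hvr : v ≠ r := by
        rintro rfl
        simp at hv
      rw [Function.iterate_succ_apply]
      apply ih
      have := hdist v hvr
      simp only [hne v hvr]
      omega
  refine ⟨fun v => if v = r then r else p v, ⟨if_pos rfl, fun v hv => ?_, hreach⟩, ?_⟩
  · simp only [hne v hv]
    exact hle (hadj v hv)
  · have hle' : functionalGraph (fun v => if v = r then r else p v) ≤ H := by
      intro u v huv
      rw [functionalGraph, SimpleGraph.fromRel_adj] at huv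
      have aux : ∀ a b, a ≠ b → (if a = r then r else p a) = b → H.Adj a b := by
        intro a b hab h
        have ha : a ≠ r := by
          rintro rfl
          exact hab (by simpa using h)
        rw [hne a ha] at h
        exact h ▸ hadj a ha
      rcases huv.2 with h | h
      · exact aux u v huv.1 h
      · exact (aux v u huv.1.symm h).symm
    exact le_antisymm hle'
      ((SimpleGraph.isTree_iff_minimal_connected.1 hH).2 (functionalGraph_connected hreach) hle')

theorem numSpanningTrees_eq_ncard_isTree (G : SimpleGraph V) :
    numSpanningTrees G = {H : SimpleGraph V | H ≤ G ∧ H.IsTree}.ncard := by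
  refine Set.ncard_congr (fun T _ => T.spanningCoe) ?_ ?_ ?_
  · rintro T ⟨hs, ht⟩
    exact ⟨T.spanningCoe_le, (T.spanningCoeEquivCoeOfSpanning hs).isTree_iff.2 ht⟩
  · rintro S T ⟨hS, -⟩ ⟨hT, -⟩ h
    refine SimpleGraph.Subgraph.ext ?_ ?_
    · rw [SimpleGraph.Subgraph.isSpanning_iff.1 hS, SimpleGraph.Subgraph.isSpanning_iff.1 hT]
    · funext u v
      exact congrArg (fun H : SimpleGraph V => H.Adj u v) h
  · rintro H ⟨hle, ht⟩
    have hs : (SimpleGraph.toSubgraph H hle).IsSpanning := SimpleGraph.toSubgraph.isSpanning H hle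
    have hH : (SimpleGraph.toSubgraph H hle).spanningCoe = H := by
      ext u v
      rfl
    refine ⟨SimpleGraph.toSubgraph H hle, ⟨hs, ?_⟩, hH⟩
    rw [← ((SimpleGraph.toSubgraph H hle).spanningCoeEquivCoeOfSpanning hs).isTree_iff, hH]
    exact ht

theorem numSpanningTrees_eq_ncard_isParentMap [Finite V] (G : SimpleGraph V) (r : V) :
    numSpanningTrees G = {f : V → V | IsParentMap G r f}.ncard := by
  rw [numSpanningTrees_eq_ncard_isTree]
  symm
  refine Set.ncard_congr (fun f _ => functionalGraph f) ?_ ?_ ?_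
  · intro f hf
    refine ⟨?_, functionalGraph_isTree hf.reaches hf.root⟩
    intro u v huv
    rw [functionalGraph, SimpleGraph.fromRel_adj] at huv
    have aux : ∀ a b, a ≠ b → f a = b → G.Adj a b := by
      rintro a _ hab rfl
      refine hf.adj a fun h => hab ?_
      rw [h, hf.root]
    rcases huv.2 with h | h
    · exact aux u v huv.1 h
    · exact (aux v u huv.1.symm h).symm
  · intro f g hf hg h
    exact functionalGraph_injOn hf.reaches hf.root hg.root h
  · rintro H ⟨hle, hH⟩
    obtain ⟨f, hf, h⟩ := hH.exists_isParentMap hle r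
    exact ⟨f, hf, h⟩

end ParentMaps

/-! ### The matrix-tree theorem and rank-one perturbations -/

section MatrixTree

open Matrix

variable {V : Type*} [Fintype V] [DecidableEq V]

/-- The matrix whose row at `r` is the unit vector `e_r` and whose row at any other `v` is
`e_v - e_{f v}`. -/
def parentMatrix (r : V) (f : V → V) : Matrix V V ℤ :=
  Matrix.of fun v => if v = r then Pi.single r 1 else Pi.single v 1 - Pi.single (f v) 1

theorem det_parentMatrix_of_reachesRoot {r : V} {f : V → V} (h : ReachesRoot f r) :
    (parentMatrix r f).det = 1 := by
  classical
  -- Vertices are graded by steps to `r`. A parent is strictly nearer, so the order is reversed to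
  -- suit `BlockTriangular`, and the diagonal blocks are identities.
  let b : V → ℕᵒᵈ := fun v => OrderDual.toDual (Nat.find (h v))
  have hlt : ∀ v, v ≠ r → Nat.find (h (f v)) < Nat.find (h v) := by
    intro v hv
    have hpos : Nat.find (h v) ≠ 0 := by
      intro h0
      have := Nat.find_spec (h v)
      rw [h0] at this
      exact hv this
    obtain ⟨k, hk⟩ := Nat.exists_eq_succ_of_ne_zero hpos
    have hs := Nat.find_spec (h v)
    rw [hk, Function.iterate_succ_apply] at hs
    have := Nat.find_min' (h (f v)) hs
    omega
  have htri : (parentMatrix r f).BlockTriangular b := by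
    intro i j hij
    have hij' : Nat.find (h i) < Nat.find (h j) := hij
    have hne : j ≠ i := by
      rintro rfl
      exact lt_irrefl _ hij'
    by_cases hi : i = r
    · subst hi
      simp [parentMatrix, hne]
    · have hne' : j ≠ f i := by
        rintro rfl
        exact lt_asymm hij' (hlt i hi)
      simp [parentMatrix, hi, hne, hne']
  rw [htri.det]
  refine Finset.prod_eq_one fun a _ => ?_
  have : (parentMatrix r f).toSquareBlock b a = 1 := by
    ext ⟨i, hi⟩ ⟨j, hj⟩
    have hij : Nat.find (h i) = Nat.find (h j) := hi.trans hj.symm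
    by_cases hir : i = r
    · subst hir
      simp [parentMatrix, toSquareBlock_def, Pi.single_apply, Matrix.one_apply, eq_comm]
    · have hne' : j ≠ f i := by
        rintro rfl
        exact (hlt i hir).ne' hij
      simp [parentMatrix, toSquareBlock_def, Pi.single_apply, Matrix.one_apply, hir, hne',
        @eq_comm _ j i]
  rw [this, det_one]

/-- The indicator of the vertices that never reach `r` is a nonzero kernel vector, because it takes
equal values at `v` and `f v` for `v ≠ r`. -/
theorem det_parentMatrix_of_not_reachesRoot {r : V} {f : V → V} (h : ¬ ReachesRoot f r) :
    (parentMatrix r f).det = 0 := by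
  classical
  rw [ReachesRoot, not_forall] at h
  obtain ⟨v₀, hv₀⟩ := h
  have hshift : ∀ v, v ≠ r → ((∃ k : ℕ, f^[k] (f v) = r) ↔ ∃ k : ℕ, f^[k] v = r) := by
    intro v hv
    constructor
    · rintro ⟨k, hk⟩
      exact ⟨k + 1, hk⟩
    · rintro ⟨k, hk⟩
      cases k with
      | zero => exact absurd hk hv
      | succ k => exact ⟨k, hk⟩
  refine Matrix.exists_mulVec_eq_zero_iff.1
    ⟨fun v => if ∃ k : ℕ, f^[k] v = r then 0 else 1, fun h0 => ?_, ?_⟩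
  · have := congrFun h0 v₀
    simp only [if_neg hv₀, Pi.zero_apply, one_ne_zero] at this
  · funext v
    by_cases hv : v = r
    · have : ∃ k : ℕ, f^[k] r = r := ⟨0, rfl⟩
      simp [mulVec, parentMatrix, hv, this]
    · have hrow : parentMatrix r f v = Pi.single v 1 - Pi.single (f v) 1 := if_neg hv
      rw [mulVec, hrow, sub_dotProduct, single_one_dotProduct, single_one_dotProduct]
      simp only [hshift v hv, sub_self, Pi.zero_apply]

/-- **Matrix-tree theorem**: the number of spanning trees is the determinant of the Laplacian with
the row of a root replaced by the unit vector of that root. -/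
theorem det_lapMatrix_updateRow_single (G : SimpleGraph V) [DecidableRel G.Adj] (r : V) :
    ((G.lapMatrix ℤ).updateRow r (Pi.single r 1)).det = numSpanningTrees G := by
  classical
  let A : V → Finset V := fun v => if v = r then {r} else G.neighborFinset v
  let g : V → V → V → ℤ := fun v u =>
    if v = r then Pi.single r 1 else Pi.single v 1 - Pi.single u 1
  -- Row `v ≠ r` of the Laplacian is the sum of `e_v - e_u` over neighbours `u`, so multilinearity
  -- turns the determinant into a sum over choices of a parent for each vertex.
  have hrow : (G.lapMatrix ℤ).updateRow r (Pi.single r 1) = fun v => ∑ u ∈ A v, g v u := by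
    funext v
    by_cases hv : v = r
    · subst hv
      simp [A, g]
    · funext w
      simp only [Matrix.updateRow_ne hv, A, g, if_neg hv, Finset.sum_sub_distrib,
        Finset.sum_const, SimpleGraph.card_neighborFinset_eq_degree, SimpleGraph.lapMatrix,
        SimpleGraph.degMatrix, Matrix.sub_apply, SimpleGraph.adjMatrix_apply, Pi.sub_apply,
        Finset.sum_apply, Pi.single_apply, Matrix.diagonal_apply]
      simp [eq_comm]
  have hexp : ((G.lapMatrix ℤ).updateRow r (Pi.single r 1)).det =
      ∑ f ∈ Fintype.piFinset A, (parentMatrix r f).det := by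
    rw [hrow]
    exact (Matrix.detRowAlternating (R := ℤ) (n := V)).toMultilinearMap.map_sum_finset g A
  have hdet : ∀ f : V → V, (parentMatrix r f).det = if ReachesRoot f r then 1 else 0 := by
    intro f
    split_ifs with h
    · exact det_parentMatrix_of_reachesRoot h
    · exact det_parentMatrix_of_not_reachesRoot h
  rw [hexp, Finset.sum_congr rfl fun f _ => hdet f, Finset.sum_boole,
    numSpanningTrees_eq_ncard_isParentMap G r, ← Set.ncard_coe_finset]
  congr 2
  ext f
  simp only [Finset.coe_filter, Fintype.mem_piFinset, Set.mem_ofPred_eq]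
  constructor
  · rintro ⟨hA, hf⟩
    refine ⟨by simpa [A] using hA r, fun v hv => ?_, hf⟩
    simpa [A, hv] using hA v
  · rintro ⟨hr, hadj, hf⟩
    refine ⟨fun v => ?_, hf⟩
    by_cases hv : v = r
    · subst hv
      simpa [A] using hr
    · simpa [A, hv] using hadj v hv

/-- A rank-one perturbation of a matrix with vanishing row and column sums. -/
theorem det_add_vecMulVec_of_sum_eq_zero {R : Type*} [CommRing R] [IsDomain R]
    (L : Matrix V V R) (hrow : L *ᵥ 1 = 0) (hcol : 1 ᵥ* L = 0) (u w : V → R) (r : V) :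
    (L + vecMulVec u w).det =
      (∑ i, u i) * (∑ i, w i) * (L.updateRow r (Pi.single r 1)).det := by
  -- Replacing row `r` by the sum of all rows keeps the determinant; once row `r` is `w`, it clears
  -- `u i • w` from the other rows.
  have h1 : (∑ k, (1 : R) • (L + vecMulVec u w) k) = (∑ i, u i) • w := by
    funext j
    have := congrFun hcol j
    simp only [vecMul, dotProduct, Pi.one_apply, one_mul, Pi.zero_apply] at this
    rw [Finset.sum_apply]
    simp [Matrix.add_apply, Finset.sum_add_distrib, this, vecMulVec_apply, Finset.sum_mul]
  have h2 : (L + vecMulVec u w).det = (∑ i, u i) * (L.updateRow r w).det := by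
    have h := det_updateRow_sum (L + vecMulVec u w) r (fun _ => 1)
    rw [h1, det_updateRow_smul, one_smul] at h
    rw [← h]
    congr 1
    refine det_eq_of_forall_row_eq_smul_add_const (fun i => if i = r then 0 else u i) r
      (if_pos rfl) fun i j => ?_
    by_cases hi : i = r
    · subst hi
      simp
    · simp [Matrix.updateRow_apply, hi, vecMulVec_apply]
  -- Now every row sums to zero, so the all-ones vector is in the kernel.
  have h3 : (L.updateRow r (w - (∑ i, w i) • Pi.single r 1)).det = 0 := by
    refine exists_mulVec_eq_zero_iff.1 ⟨1, fun h => one_ne_zero (congrFun h r), ?_⟩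
    funext v
    by_cases hv : v = r
    · subst hv
      simp [mulVec, dotProduct_one, ← Finset.mul_sum]
    · have := congrFun hrow v
      simpa [mulVec, Matrix.updateRow_ne hv] using this
  rw [h2, mul_assoc]
  congr 1
  conv_lhs => rw [← sub_add_cancel w ((∑ i, w i) • Pi.single r 1)]
  rw [det_updateRow_add, det_updateRow_smul, h3, zero_add]

end MatrixTree

/-! ### Swap-symmetric block matrices and the path Laplacian -/

section Determinants

open Matrix

/-- Conjugation by a unipotent block matrix makes it block triangular, with no division by `2`. -/
theorem det_fromBlocks_swap {m R : Type*} [Fintype m] [DecidableEq m] [CommRing R]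
    (A B : Matrix m m R) : (fromBlocks A B B A).det = (A + B).det * (A - B).det := by
  have h : fromBlocks 1 0 (-1) 1 * fromBlocks A B B A * fromBlocks 1 0 1 1 =
      fromBlocks (A + B) B 0 (A - B) := by
    simp only [fromBlocks_multiply]
    congr 1 <;> (simp; try abel)
  have := congrArg det h
  simpa [det_mul, det_fromBlocks_zero₂₁, det_fromBlocks_zero₁₂] using this

/-- The matrix of the backward difference operator on `Fin N`. -/
def backwardDiff (N : ℕ) : Matrix (Fin N) (Fin N) ℤ :=
  Matrix.of fun i j => if i = j then 1 else if (j : ℕ) + 1 = i then -1 else 0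

theorem det_backwardDiff (N : ℕ) : (backwardDiff N).det = 1 := by
  rw [det_of_isLowerTriangular]
  · simp [backwardDiff]
  · intro i j hij
    have hij' : (i : ℕ) < j := hij
    have h1 : i ≠ j := fun h => by simp [h] at hij'
    have h2 : (j : ℕ) + 1 ≠ i := by omega
    simp [backwardDiff, h1, h2]

/-- Column `i` has entries only in rows `i` and `i + 1`, the latter missing for the last column. The
product is the path Laplacian with `1` added at position `0`. -/
theorem backwardDiff_transpose_mul_self_apply (N : ℕ) (i j : Fin N) :
    ((backwardDiff N)ᵀ * backwardDiff N) i j =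
      if i = j then (if (i : ℕ) + 1 = N then 1 else 2)
      else if (i : ℕ) + 1 = j ∨ (j : ℕ) + 1 = i then -1 else 0 := by
  have hk : ∀ k : Fin N, (backwardDiff N)ᵀ i k * backwardDiff N k j =
      (if k = i then backwardDiff N i j else 0) -
        (if (i : ℕ) + 1 = k then backwardDiff N k j else 0) := by
    intro k
    by_cases h1 : k = i
    · subst h1
      simp [backwardDiff]
    · by_cases h2 : (i : ℕ) + 1 = k <;> simp [backwardDiff, h1, h2, neg_ite]
  rw [mul_apply, Finset.sum_congr rfl fun k _ => hk k, Finset.sum_sub_distrib,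
    Finset.sum_ite_eq' Finset.univ i]
  by_cases hi : (i : ℕ) + 1 = N
  · have h0 : ∑ k : Fin N, (if (i : ℕ) + 1 = k then backwardDiff N k j else 0) = 0 :=
      Finset.sum_eq_zero fun k _ => if_neg (by omega)
    rw [h0]
    simp only [backwardDiff, of_apply, Finset.mem_univ, if_true, Fin.ext_iff]
    split_ifs <;> omega
  · have hlt : (i : ℕ) + 1 < N := by omega
    have h0 : ∑ k : Fin N, (if (i : ℕ) + 1 = k then backwardDiff N k j else 0) =
        backwardDiff N ⟨i + 1, hlt⟩ j := by
      rw [Finset.sum_eq_single ⟨(i : ℕ) + 1, hlt⟩]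
      · simp
      · intro k _ hk
        exact if_neg fun h => hk (Fin.ext h.symm)
      · simp
    rw [h0]
    simp only [backwardDiff, of_apply, Finset.mem_univ, if_true, Fin.ext_iff]
    split_ifs <;> omega

end Determinants

/-! ### Block decomposition for the crossed octagonal graph -/

section CrossedOctagonal

open Matrix

instance (n : ℕ) : DecidableRel (linearCrossedOctagonalGraph n).Adj := fun u v =>
  inferInstanceAs (Decidable (((u.1 : ℕ) + 1 = v.1 ∨ (v.1 : ℕ) + 1 = u.1) ∨
      (u.1 = v.1 ∧ u.2 ≠ v.2 ∧ 3 ∣ (u.1 : ℕ))))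

/-- The number of rungs at position `i`. -/
def rungNumber (i : ℕ) : ℕ := if 3 ∣ i then 1 else 0

/-- The degree of the position `i` in a path on `N` vertices. -/
def pathDegree (N i : ℕ) : ℕ := (if i = 0 then 0 else 1) + (if i + 1 = N then 0 else 1)

theorem sum_path_adj (N : ℕ) (i : Fin N) :
    ∑ j : Fin N, (if (i : ℕ) + 1 = j ∨ (j : ℕ) + 1 = i then 1 else 0) = pathDegree N i := by
  have hsplit : ∀ j : Fin N, (if (i : ℕ) + 1 = j ∨ (j : ℕ) + 1 = i then 1 else 0) =
      (if (j : ℕ) + 1 = i then 1 else 0) + (if (i : ℕ) + 1 = j then 1 else 0) := by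
    intro j
    split_ifs <;> omega
  rw [Finset.sum_congr rfl fun j _ => hsplit j, Finset.sum_add_distrib, pathDegree]
  congr 1
  · split_ifs with h
    · exact Finset.sum_eq_zero fun j _ => if_neg (by omega)
    · rw [Finset.sum_eq_single ⟨(i : ℕ) - 1, by omega⟩]
      · exact if_pos (by simp only; omega)
      · intro j _ hj
        exact if_neg fun h' => hj (Fin.ext (by simp only; omega))
      · simp
  · split_ifs with h
    · exact Finset.sum_eq_zero fun j _ => if_neg (by omega)
    · rw [Finset.sum_eq_single ⟨(i : ℕ) + 1, by omega⟩]
      · exact if_pos rfl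
      · intro j _ hj
        exact if_neg fun h' => hj (Fin.ext h'.symm)
      · simp

theorem degree_linearCrossedOctagonalGraph (n : ℕ) (u : Fin (3 * n + 1) × Bool) :
    (linearCrossedOctagonalGraph n).degree u =
      2 * pathDegree (3 * n + 1) u.1 + rungNumber u.1 := by
  obtain ⟨i, b⟩ := u
  have hsplit : ∀ j : Fin (3 * n + 1), ∑ c : Bool,
      (if (linearCrossedOctagonalGraph n).Adj (i, b) (j, c) then 1 else 0) =
      2 * (if (i : ℕ) + 1 = j ∨ (j : ℕ) + 1 = i then 1 else 0) +
        (if j = i then rungNumber i else 0) := by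
    intro j
    by_cases hij : j = i
    · subst hij
      cases b <;> by_cases h3 : 3 ∣ (j : ℕ) <;>
        simp [linearCrossedOctagonalGraph, rungNumber, h3]
    · have hij' : ¬ i = j := fun h => hij h.symm
      by_cases h : (i : ℕ) + 1 = j ∨ (j : ℕ) + 1 = i <;>
        simp [linearCrossedOctagonalGraph, hij, hij', h]
  rw [← SimpleGraph.card_neighborFinset_eq_degree, SimpleGraph.neighborFinset_eq_filter,
    Finset.card_filter, Fintype.sum_prod_type, Finset.sum_congr rfl fun j _ => hsplit j,
    Finset.sum_add_distrib, ← Finset.mul_sum, sum_path_adj]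
  simp

/-- The indicator of the two vertices at position `0`. -/
def initialIndicator (n : ℕ) : Fin (3 * n + 1) × Bool → ℤ := fun u =>
  if (u.1 : ℕ) = 0 then 1 else 0

theorem sum_initialIndicator (n : ℕ) : ∑ u, initialIndicator n u = 2 := by
  rw [Fintype.sum_prod_type, Finset.sum_eq_single 0]
  · simp [initialIndicator]
  · intro i _ hi
    simp [initialIndicator, hi]
  · simp

/-- The block of the Laplacian, perturbed at position `0`, between vertices of the same path. -/
def sameBlock (n : ℕ) : Matrix (Fin (3 * n + 1)) (Fin (3 * n + 1)) ℤ := Matrix.of fun i j =>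
  if i = j then 2 * pathDegree (3 * n + 1) i + rungNumber i + (if (i : ℕ) = 0 then 1 else 0)
  else if (i : ℕ) + 1 = j ∨ (j : ℕ) + 1 = i then -1 else 0

/-- The block of the Laplacian, perturbed at position `0`, between vertices of distinct paths. -/
def crossBlock (n : ℕ) : Matrix (Fin (3 * n + 1)) (Fin (3 * n + 1)) ℤ := Matrix.of fun i j =>
  if i = j then -rungNumber i + (if (i : ℕ) = 0 then 1 else 0)
  else if (i : ℕ) + 1 = j ∨ (j : ℕ) + 1 = i then -1 else 0

theorem lapMatrix_linearCrossedOctagonalGraph_apply (n : ℕ) (i j : Fin (3 * n + 1)) (b c : Bool) :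
    ((linearCrossedOctagonalGraph n).lapMatrix ℤ +
      vecMulVec (initialIndicator n) (initialIndicator n)) (i, b) (j, c) =
      if b = c then sameBlock n i j else crossBlock n i j := by
  simp only [SimpleGraph.lapMatrix, SimpleGraph.degMatrix, Matrix.add_apply, Matrix.sub_apply,
    SimpleGraph.adjMatrix_apply, vecMulVec_apply, diagonal_apply,
    degree_linearCrossedOctagonalGraph, initialIndicator, sameBlock, crossBlock, of_apply]
  by_cases hij : i = j
  · subst hij
    by_cases hbc : b = c
    · subst hbc
      simp
    · by_cases h3 : 3 ∣ (i : ℕ) <;>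
        simp [linearCrossedOctagonalGraph, hbc, rungNumber, h3]
  · have h0 : ¬ ((i : ℕ) = 0 ∧ (j : ℕ) = 0) := fun h => hij (Fin.ext (h.1.trans h.2.symm))
    have h0' : (if (i : ℕ) = 0 then (1 : ℤ) else 0) * (if (j : ℕ) = 0 then 1 else 0) = 0 := by
      split_ifs <;> simp_all
    rw [h0']
    by_cases h : (i : ℕ) + 1 = j ∨ (j : ℕ) + 1 = i <;>
      simp [linearCrossedOctagonalGraph, hij, h]

theorem sameBlock_add_crossBlock (n : ℕ) :
    sameBlock n + crossBlock n =
      (2 : ℤ) • ((backwardDiff (3 * n + 1))ᵀ * backwardDiff (3 * n + 1)) := by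
  ext i j
  rw [Matrix.smul_apply, backwardDiff_transpose_mul_self_apply]
  simp only [Matrix.add_apply, sameBlock, crossBlock, of_apply, pathDegree]
  split_ifs <;> simp <;> omega

theorem sameBlock_sub_crossBlock (n : ℕ) :
    sameBlock n - crossBlock n = diagonal fun i : Fin (3 * n + 1) =>
      (2 * (pathDegree (3 * n + 1) i + rungNumber i) : ℤ) := by
  ext i j
  simp only [Matrix.sub_apply, sameBlock, crossBlock, of_apply, diagonal_apply]
  split_ifs <;> ring

/-- Both ends give `2 * (1 + 1) = 4`, inner rungs `2 * (2 + 1) = 6`, other positions `4`; each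
further octagon contributes `4 * 4 * 6 = 96`. -/
theorem prod_pathDegree_add_rungNumber (m : ℕ) :
    ∏ i : Fin (3 * (m + 1) + 1),
      (2 * (pathDegree (3 * (m + 1) + 1) i + rungNumber i) : ℤ) = 256 * 96 ^ m := by
  have hinner : ∀ k : ℕ, ∏ i ∈ Finset.range (3 * (k + 1)),
      (if i = 0 then 4 else if 3 ∣ i then 6 else 4 : ℤ) = 64 * 96 ^ k := by
    intro k
    induction k with
    | zero => simp [Finset.prod_range_succ]
    | succ k ih =>
      rw [show 3 * (k + 1 + 1) = 3 * (k + 1) + 1 + 1 + 1 by ring, Finset.prod_range_succ,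
        Finset.prod_range_succ, Finset.prod_range_succ, ih, if_neg (by omega), if_pos (by omega),
        if_neg (by omega), if_neg (by omega), if_neg (by omega), if_neg (by omega)]
      ring
  rw [Fin.prod_univ_eq_prod_range
    (fun i => (2 * (pathDegree (3 * (m + 1) + 1) i + rungNumber i) : ℤ)), Finset.prod_range_succ]
  have hcongr : ∀ i ∈ Finset.range (3 * (m + 1)),
      (2 * (pathDegree (3 * (m + 1) + 1) i + rungNumber i) : ℤ) =
        if i = 0 then 4 else if 3 ∣ i then 6 else 4 := by
    intro i hi
    have hi' := Finset.mem_range.1 hi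
    have hlast : i ≠ 3 * (m + 1) := by omega
    by_cases h0 : i = 0
    · simp [pathDegree, rungNumber, h0]
    · by_cases h3 : 3 ∣ i <;> simp [pathDegree, rungNumber, h0, h3, hlast]
  rw [Finset.prod_congr rfl hcongr, hinner]
  simp [pathDegree, rungNumber]
  ring

theorem det_lapMatrix_linearCrossedOctagonalGraph_add (n : ℕ) :
    ((linearCrossedOctagonalGraph n).lapMatrix ℤ +
      vecMulVec (initialIndicator n) (initialIndicator n)).det =
      (sameBlock n + crossBlock n).det * (sameBlock n - crossBlock n).det := by
  let e : Fin (3 * n + 1) ⊕ Fin (3 * n + 1) ≃ Fin (3 * n + 1) × Bool :=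
    (Equiv.boolProdEquivSum _).symm.trans (Equiv.prodComm _ _)
  rw [← det_fromBlocks_swap, ← det_submatrix_equiv_self e]
  congr 1
  ext (i | i) (j | j) <;>
    exact lapMatrix_linearCrossedOctagonalGraph_apply n i j _ _

end CrossedOctagonal

theorem theorem1p4 (n : ℕ) (hn : 1 ≤ n) :
    numSpanningTrees (linearCrossedOctagonalGraph n) = 2 ^ (8 * n + 2) * 3 ^ (n - 1) := by
  obtain ⟨m, rfl⟩ := Nat.exists_eq_add_of_le' hn
  have hrow : ((linearCrossedOctagonalGraph (m + 1)).lapMatrix ℤ).mulVec 1 = 0 :=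
    SimpleGraph.lapMatrix_mulVec_const_eq_zero _
  have hcol : Matrix.vecMul 1 ((linearCrossedOctagonalGraph (m + 1)).lapMatrix ℤ) = 0 := by
    rw [← Matrix.mulVec_transpose, SimpleGraph.isSymm_lapMatrix]
    exact hrow
  have h := det_add_vecMulVec_of_sum_eq_zero _ hrow hcol
    (initialIndicator (m + 1)) (initialIndicator (m + 1)) (0, false)
  rw [det_lapMatrix_updateRow_single, det_lapMatrix_linearCrossedOctagonalGraph_add, sum_initialIndicator,
    sameBlock_add_crossBlock, sameBlock_sub_crossBlock, Matrix.det_smul, Matrix.det_mul,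
    Matrix.det_transpose, det_backwardDiff, Matrix.det_diagonal, prod_pathDegree_add_rungNumber,
    Fintype.card_fin] at h
  -- The factor `4` is the square of the sum of `initialIndicator`.
  have h4 : (4 : ℤ) * (numSpanningTrees (linearCrossedOctagonalGraph (m + 1)) : ℤ) =
      4 * (2 ^ (8 * (m + 1) + 2) * 3 ^ (m + 1 - 1)) := by
    have h96 : (96 : ℤ) ^ m = 2 ^ (5 * m) * 3 ^ m := by
      rw [pow_mul, ← mul_pow]
      norm_num
    rw [h96] at h
    rw [Nat.add_sub_cancel]
    linear_combination (exp := 1) -h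
  exact_mod_cast mul_left_cancel₀ (by norm_num) h4
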